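/- Let $\{\beta_j\}_{j\ge 0}$, $\{\gamma_i\}$, $\{p_i\}$ be nonnegative real sequences with $\sum_{j=0}^{\infty}\beta_j=1$, $p_1\le 1$, and $0<\gamma_i+p_i\le 1$ for all $i\ge 2$. Let $(X_n)_{n\ge 0}$ be the Markov chain on $\mathbb{Z}^+=\{0,1,2,\dots\}$ with one-step transition probabilities $$P_{ij}=\begin{cases}\beta_j, & i=0,\ j\ge 0,\\ \gamma_i, & i\ge 2,\ j=0,\\ p_i, & i\ge 1,\ j=i-1,\\ 1-p_i-\gamma_i\mathbf 1_{\{i\ge 2\}}, & i\ge 1,\ j=i,\\ 0, & \text{otherwise,}\end{cases}$$ and assume that the chain is irreducible with respect to the counting measure. Write $\tau_C^+=\inf\{n\ge 1: X_n\in C\}$. A set $C\subseteq\mathbb{Z}^+$ is called petite if there are a probability distribution $(a_n)_{n\ge0}$ on $\mathbb{Z}^+$ and a nonzero measure $\nu$ with $\sum_{n\ge 0}a_nP^n(x,B)\ge\nu(B)$ for all $x\in C$ and all $B\subseteq\mathbb{Z}^+$. The chain is called *ergodic* if it is Harris recurrent (from every initial state, every nonempty set is visited infinitely often almost surely) and $\sup_{x\in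 C}\mathbb{E}_x\tau_C^+<\infty$ for some nonempty petite set $C$; *geometrically ergodic* if $\sup_{x\in C}\mathbb{E}_x r^{\tau_C^+}<\infty$ for some nonempty petite set $C$ and some $r>1$; *strongly ergodic* if $\sup_{x\in\mathbb{Z}^+}\mathbb{E}_x\tau_C^+<\infty$ for some petite set $C$. Then: (1) $(X_n)$ is not ergodic if there exists $i_0>0$ such that $\sum_{j=i_0}^{\infty}\dfrac{\beta_j}{p_j+\gamma_j}=\infty$; (2) $(X_n)$ is not geometrically ergodic if there exists $a>0$ such that $\gamma_i+a\,p_i\le i^{-a}$ for all $i\ge 2$; (3) $(X_n)$ is not strongly ergodic if $\inf_{i\ge 2}(p_i+\gamma_i)=0$. -/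

import Mathlib

open MeasureTheory ProbabilityTheory Filter
open scoped ENNReal NNReal

noncomputable section

namespace MarkovChain

/-! ### Markov chains on a measurable state space -/

section General

variable {S : Type*} [MeasurableSpace S]

/-- The law `ℙ_x`, on the path space `ℕ → S`, of the homogeneous Markov chain `(X_n)` with one-step
transition kernel `P` and `X_0 = x`; here `X_n` is the `n`-th coordinate map. -/
def pathLaw (P : Kernel S S) [IsMarkovKernel P] (x : S) : Measure (ℕ → S) :=
  Kernel.traj (X := fun _ => S)
    (fun n => P.comap (fun h : (Finset.Iic n → S) => h ⟨n, Finset.mem_Iic.2 le_rfl⟩)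
      (measurable_pi_apply _))
    0 (fun _ => x)

/-- The first return time `τ_A⁺ = inf {n ≥ 1 : X_n ∈ A}`, with `inf ∅ = ∞`. -/
def returnTime (A : Set S) (ω : ℕ → S) : ℕ∞ :=
  ⨅ (n : ℕ) (_ : 1 ≤ n ∧ ω n ∈ A), (n : ℕ∞)

/-- `r ^ t` for a number `r > 1` and a possibly infinite time `t`, with `r ^ ∞ = ∞`. -/
def powTime (r : ℝ≥0) : ℕ∞ → ℝ≥0∞
  | ⊤ => ⊤
  | (n : ℕ) => (r : ℝ≥0∞) ^ n

/-- The mean return time `𝔼_x τ_A⁺`. -/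
def meanReturnTime (P : Kernel S S) [IsMarkovKernel P] (A : Set S) (x : S) : ℝ≥0∞ :=
  ∫⁻ ω, (returnTime A ω : ℝ≥0∞) ∂(pathLaw P x)

/-- The exponential moment `𝔼_x r ^ τ_A⁺` of the return time. -/
def expReturnMoment (P : Kernel S S) [IsMarkovKernel P] (r : ℝ≥0) (A : Set S) (x : S) : ℝ≥0∞ :=
  ∫⁻ ω, powTime r (returnTime A ω) ∂(pathLaw P x)

/-- `A` is petite: for some probability distribution `a` on `ℕ` and some nontrivial measure `ν`,
`∑ n, a n * P ^ n (x, B) ≥ ν B` for all `x ∈ A` and all measurable `B`. -/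
def IsPetite (P : Kernel S S) (A : Set S) : Prop :=
  MeasurableSet A ∧ ∃ (a : ℕ → ℝ≥0∞) (ν : Measure S), ∑' n, a n = 1 ∧ ν ≠ 0 ∧
    ∀ x ∈ A, ∀ B, MeasurableSet B → ν B ≤ ∑' n, a n * (P ^ n) x B

/-- Harris recurrence with respect to the (maximal irreducibility) measure `ψ`: every measurable
set of positive `ψ`-measure is almost surely visited infinitely often, from every initial state. -/
def IsHarrisRecurrent (P : Kernel S S) [IsMarkovKernel P] (ψ : Measure S) : Prop :=
  ∀ A, MeasurableSet A → 0 < ψ A → ∀ x, ∀ᵐ ω ∂(pathLaw P x), ∃ᶠ n in atTop, ω n ∈ A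

/-- Ergodicity: (Harris) recurrence, together with a petite set `C`, `ψ C > 0`, such that
`sup_{x ∈ C} 𝔼_x τ_C⁺ < ∞`. -/
def IsErgodic (P : Kernel S S) [IsMarkovKernel P] (ψ : Measure S) : Prop :=
  IsHarrisRecurrent P ψ ∧
    ∃ C, IsPetite P C ∧ 0 < ψ C ∧ (⨆ x ∈ C, meanReturnTime P C x) < ∞

/-- Geometric ergodicity: there are a petite set `C`, `ψ C > 0`, and `r > 1` such that
`sup_{x ∈ C} 𝔼_x r ^ τ_C⁺ < ∞`. -/
def IsGeometricallyErgodic (P : Kernel S S) [IsMarkovKernel P] (ψ : Measure S) : Prop :=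
  ∃ C, IsPetite P C ∧ 0 < ψ C ∧ ∃ r : ℝ≥0, 1 < r ∧ (⨆ x ∈ C, expReturnMoment P r C x) < ∞

/-- Strong (uniform) ergodicity: there is a petite set `C` such that `sup_x 𝔼_x τ_C⁺ < ∞`, the
supremum being over the whole state space. -/
def IsStronglyErgodic (P : Kernel S S) [IsMarkovKernel P] : Prop :=
  ∃ C, IsPetite P C ∧ (⨆ x, meanReturnTime P C x) < ∞

end General

/-! ### The single-death chain with immigration -/

/-- Parameters of the single-death chain with immigration (the values `p 0`, `γ 0`, `γ 1` play no
role in the transition matrix). -/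
structure SingleDeath where
  β : ℕ → ℝ
  γ : ℕ → ℝ
  p : ℕ → ℝ
  β_nonneg : ∀ i, 0 ≤ β i
  γ_nonneg : ∀ i, 0 ≤ γ i
  p_nonneg : ∀ i, 0 ≤ p i
  hasSum_β : HasSum β 1
  p_one_le : p 1 ≤ 1
  pos : ∀ i, 2 ≤ i → 0 < γ i + p i
  le_one : ∀ i, 2 ≤ i → γ i + p i ≤ 1

namespace SingleDeath

/-- The transition matrix `P_ij`. -/
def matrix (R : SingleDeath) (i j : ℕ) : ℝ :=
  if i = 0 then R.β j
  else if 2 ≤ i ∧ j = 0 then R.γ i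
  else if j + 1 = i then R.p i
  else if j = i then 1 - R.p i - (if 2 ≤ i then R.γ i else 0)
  else 0

/-- The `i`-th row of the transition matrix, as a measure on `ℕ`. -/
def row (R : SingleDeath) (i : ℕ) : Measure ℕ :=
  Measure.sum fun j => ENNReal.ofReal (R.matrix i j) • Measure.dirac j

/-- The transition kernel with matrix `P_ij`. -/
def kernel (R : SingleDeath) : Kernel ℕ ℕ := Kernel.ofFunOfCountable R.row

theorem matrix_nonneg (R : SingleDeath) (i j : ℕ) : 0 ≤ R.matrix i j := by
  unfold matrix
  have h1 := R.p_one_le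
  have h2 := R.le_one i
  have h3 := R.β_nonneg j
  have h4 := R.γ_nonneg i
  have h5 := R.p_nonneg i
  split_ifs with h h' h'' h''' h4'
  · exact h3
  · exact h4
  · exact h5
  · linarith [h2 h4']
  · have : i = 1 := by omega
    subst this
    linarith
  · exact le_rfl

theorem hasSum_matrix (R : SingleDeath) (i : ℕ) : HasSum (R.matrix i) 1 := by
  rcases Nat.lt_or_ge i 2 with hi | hi
  · interval_cases i
    · have h : R.matrix 0 = R.β := by
        funext j
        simp [matrix]
      rw [h]
      exact R.hasSum_β
    · have h : ∑ j ∈ ({0, 1} : Finset ℕ), R.matrix 1 j = 1 := by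
        simp [matrix]
      rw [← h]
      refine hasSum_sum_of_ne_finset_zero fun j hj => ?_
      simp only [Finset.mem_insert, Finset.mem_singleton, not_or] at hj
      simp [matrix, hj.1, hj.2]
  · obtain ⟨k, rfl⟩ : ∃ k, i = k + 2 := ⟨i - 2, by omega⟩
    have h : ∑ j ∈ ({0, k + 1, k + 2} : Finset ℕ), R.matrix (k + 2) j = 1 := by
      rw [Finset.sum_insert (by simp), Finset.sum_insert (by simp), Finset.sum_singleton]
      simp [matrix]
      ring
    rw [← h]
    refine hasSum_sum_of_ne_finset_zero fun j hj => ?_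
    simp only [Finset.mem_insert, Finset.mem_singleton, not_or] at hj
    simp [matrix, hj.1, hj.2.1, hj.2.2]

instance isMarkovKernel_kernel (R : SingleDeath) : IsMarkovKernel R.kernel := by
  refine ⟨fun i => ⟨?_⟩⟩
  change R.row i Set.univ = 1
  have h := R.hasSum_matrix i
  simp only [row, Measure.sum_apply _ MeasurableSet.univ, Measure.smul_apply, measure_univ,
    smul_eq_mul, mul_one]
  rw [← ENNReal.ofReal_tsum_of_nonneg (R.matrix_nonneg i) h.summable, h.tsum_eq,
    ENNReal.ofReal_one]

end SingleDeath

end MarkovChain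

end

/-! Write `q i = p i + γ i`. For `i ≥ 2` this is the probability of leaving `i`, so small `q i`
means a long stay at `i`. Two facts turn this into non-ergodicity. A petite set contains only states
`i ≥ 2` with `q i` bounded below (`exists_le_of_isPetite`). Off `C`, the series `G_r(x) = ∑ r ^ n
ℙ_x(τ_C⁺ > n)` satisfies `G_r(i) ≥ 1 + r (1 - q i) G_r(i)` (`one_add_le_tailSeries`).

Moment bounds on `C` make `G_r` finite on `C`, and irreducibility makes it finite everywhere
(`tailSeries_ne_top`). For (1), finiteness of `G_1(0)` bounds `∑ β_j / q_j`; for (2), `q i → 0`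
yields a state with `G_r(i) ≥ 1 + G_r(i)`; for (3), a uniform bound on `G_1` bounds `q` below. -/

namespace MarkovChain

/-! ### Tails of the return time along a single path -/

section Paths

variable {S : Type*}

/-- The paths that do not visit `C` at the times `1, …, n`. -/
def avoid (C : Set S) (n : ℕ) : Set (ℕ → S) :=
  {ω | ∀ m, 1 ≤ m → m ≤ n → ω m ∉ C}

/-- The initial segments, up to time `n`, of the paths in `avoid C n`. -/
def avoidSegment (C : Set S) (n : ℕ) : Set (Finset.Iic n → S) :=
  {h | ∀ m : Finset.Iic n, 1 ≤ (m : ℕ) → h m ∉ C}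

theorem avoid_eq_preimage (C : Set S) (n : ℕ) :
    avoid C n = Preorder.frestrictLe n ⁻¹' avoidSegment C n := by
  ext ω
  simp only [avoid, avoidSegment, Set.mem_ofPred_eq, Set.mem_preimage, Preorder.frestrictLe_apply,
    Subtype.forall, Finset.mem_Iic]
  exact forall_congr' fun m => ⟨fun h h1 h2 => h h2 h1, fun h h1 h2 => h h2 h1⟩

theorem avoid_succ (C : Set S) (n : ℕ) :
    avoid C (n + 1) = avoid C n ∩ {ω | ω (n + 1) ∈ Cᶜ} := by
  ext ω
  constructor
  · exact fun h => ⟨fun m h1 h2 => h m h1 (by omega), h (n + 1) (by omega) le_rfl⟩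
  · rintro ⟨h1, h2⟩ m hm hm'
    rcases Nat.lt_or_ge n m with h | h
    · obtain rfl : m = n + 1 := by omega
      exact h2
    · exact h1 m hm h

theorem lt_returnTime_of_mem_avoid {C : Set S} {n m : ℕ} {ω : ℕ → S} (hω : ω ∈ avoid C n)
    (hm : returnTime C ω = m) : n < m := by
  have h : ((n + 1 : ℕ) : ℕ∞) ≤ returnTime C ω := by
    refine le_iInf₂ fun k hk => ?_
    by_contra hlt
    have : k < n + 1 := by exact_mod_cast not_le.1 hlt
    exact hω k hk.1 (by omega) hk.2
  rw [hm] at h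
  exact_mod_cast h

theorem tsum_indicator_avoid_le {C : Set S} (r : ℝ≥0∞) {m : ℕ} {ω : ℕ → S}
    (hm : returnTime C ω = m) :
    ∑' n, r ^ n * (avoid C n).indicator 1 ω ≤ ∑ n ∈ Finset.range m, r ^ n := by
  rw [tsum_eq_sum (s := Finset.range m)]
  · refine Finset.sum_le_sum fun n _ => ?_
    by_cases h : ω ∈ avoid C n <;> simp [h]
  · intro n hn
    have : ω ∉ avoid C n := fun h => hn (Finset.mem_range.2 (lt_returnTime_of_mem_avoid h hm))
    simp [this]

/-- The geometric sum formula with its `-1` dropped, so that no subtraction occurs in `ℝ≥0∞`. -/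
theorem mul_geom_sum_le_pow (s : ℝ≥0∞) (m : ℕ) :
    s * ∑ n ∈ Finset.range m, (1 + s) ^ n ≤ (1 + s) ^ m := by
  induction m with
  | zero => simp
  | succ m ih =>
    rw [Finset.sum_range_succ, mul_add, pow_succ (1 + s) m, mul_add, mul_one, mul_comm _ s]
    gcongr

end Paths

/-! ### Taboo probabilities and the tail series -/

section General

variable {S : Type*} [MeasurableSpace S]

/-- The taboo operator: one step of the chain, killed on entering `C`. -/
noncomputable def taboo (P : Kernel S S) (C : Set S) (f : S → ℝ≥0∞) (x : S) : ℝ≥0∞ :=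
  ∫⁻ y in Cᶜ, f y ∂(P x)

theorem measurable_taboo (P : Kernel S S) [IsMarkovKernel P] {C : Set S} (hC : MeasurableSet C)
    {f : S → ℝ≥0∞} (hf : Measurable f) : Measurable (taboo P C f) :=
  hf.setLIntegral_kernel hC.compl

theorem measurable_iterate_taboo (P : Kernel S S) [IsMarkovKernel P] {C : Set S}
    (hC : MeasurableSet C) {f : S → ℝ≥0∞} (hf : Measurable f) (n : ℕ) :
    Measurable ((taboo P C)^[n] f) := by
  induction n generalizing f with
  | zero => exact hf
  | succ n ih => exact ih (measurable_taboo P hC hf)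

theorem measurableSet_avoidSegment {C : Set S} (hC : MeasurableSet C) (n : ℕ) :
    MeasurableSet (avoidSegment C n) := by
  have : avoidSegment C n =
      ⋂ m : Finset.Iic n, {h | 1 ≤ (m : ℕ) → h m ∉ C} := by
    ext h; simp [avoidSegment]
  rw [this]
  refine MeasurableSet.iInter fun m => ?_
  by_cases hm : 1 ≤ (m : ℕ)
  · simp only [hm, forall_const]
    exact ((measurable_pi_apply (X := fun _ : Finset.Iic n => S) m) hC).compl
  · simp [hm]

theorem measurableSet_avoid {C : Set S} (hC : MeasurableSet C) (n : ℕ) :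
    MeasurableSet (avoid C n) := by
  rw [avoid_eq_preimage]
  exact Preorder.measurable_frestrictLe n (measurableSet_avoidSegment hC n)

instance (P : Kernel S S) [IsMarkovKernel P] (x : S) : IsProbabilityMeasure (pathLaw P x) := by
  unfold pathLaw; infer_instance

/-- The Markov property at time `n`: given the path up to time `n`, the next state has the law
`P (X_n)`. -/
theorem lintegral_pathLaw_succ (P : Kernel S S) [IsMarkovKernel P] (x : S) (n : ℕ)
    {g : (Finset.Iic n → S) → ℝ≥0∞} (hg : Measurable g) {f : S → ℝ≥0∞} (hf : Measurable f) :
    ∫⁻ ω, g (Preorder.frestrictLe n ω) * f (ω (n + 1)) ∂(pathLaw P x) =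
      ∫⁻ ω, g (Preorder.frestrictLe n ω) * ∫⁻ y, f y ∂(P (ω n)) ∂(pathLaw P x) := by
  let κ : (n : ℕ) → Kernel (Finset.Iic n → S) S :=
    fun n => P.comap (fun h : (Finset.Iic n → S) => h ⟨n, Finset.mem_Iic.2 le_rfl⟩)
      (measurable_pi_apply _)
  have hlaw : pathLaw P x = Kernel.traj (X := fun _ => S) κ 0 (fun _ => x) := rfl
  have key := Kernel.partialTraj_compProd_eq_map_traj (X := fun _ => S) (κ := κ) (Nat.zero_le n)
    (x₀ := fun _ => x)
  have hF : Measurable fun z : (Finset.Iic n → S) × S => g z.1 * f z.2 := by fun_prop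
  have hP : Measurable fun h : (Finset.Iic n → S) => ∫⁻ y, f y ∂(κ n h) := hf.lintegral_kernel
  calc
    _ = ∫⁻ z, g z.1 * f z.2 ∂((Kernel.traj (X := fun _ => S) κ 0 (fun _ => x)).map
          fun ω => (Preorder.frestrictLe n ω, ω (n + 1))) := by
      rw [lintegral_map hF (by fun_prop), hlaw]
    _ = ∫⁻ h, ∫⁻ y, g h * f y ∂(κ n h) ∂(Kernel.partialTraj (X := fun _ => S) κ 0 n
          (fun _ => x)) := by
      rw [← key, Measure.lintegral_compProd hF]
    _ = ∫⁻ h, g h * ∫⁻ y, f y ∂(κ n h) ∂(Kernel.partialTraj (X := fun _ => S) κ 0 n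
          (fun _ => x)) := by
      simp_rw [lintegral_const_mul _ hf]
    _ = _ := by
      rw [← Kernel.traj_map_frestrictLe_apply, lintegral_map (f := fun h => g h * ∫⁻ y, f y ∂(κ n h))
        (hg.mul hP) (by fun_prop), hlaw]
      rfl

theorem lintegral_pathLaw_zero (P : Kernel S S) [IsMarkovKernel P] (x : S)
    {f : S → ℝ≥0∞} (hf : Measurable f) : ∫⁻ ω, f (ω 0) ∂(pathLaw P x) = f x := by
  let κ : (n : ℕ) → Kernel (Finset.Iic n → S) S :=
    fun n => P.comap (fun h : (Finset.Iic n → S) => h ⟨n, Finset.mem_Iic.2 le_rfl⟩)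
      (measurable_pi_apply _)
  have hlaw : pathLaw P x = Kernel.traj (X := fun _ => S) κ 0 (fun _ => x) := rfl
  have key := Kernel.traj_map_frestrictLe_apply (X := fun _ => S) (κ := κ) 0 0 (fun _ => x)
  have hF : Measurable fun h : (Finset.Iic 0 → S) => f (h ⟨0, Finset.mem_Iic.2 le_rfl⟩) := by
    fun_prop
  rw [hlaw]
  calc
    _ = ∫⁻ h, f (h ⟨0, Finset.mem_Iic.2 le_rfl⟩)
          ∂((Kernel.traj (X := fun _ => S) κ 0 (fun _ => x)).map (Preorder.frestrictLe 0)) := by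
      rw [lintegral_map hF (by fun_prop)]
      rfl
    _ = f x := by
      rw [key, Kernel.partialTraj_self, Kernel.id_apply, lintegral_dirac' _ hF]

theorem setLIntegral_avoid (P : Kernel S S) [IsMarkovKernel P] {C : Set S} (hC : MeasurableSet C)
    (x : S) (n : ℕ) {f : S → ℝ≥0∞} (hf : Measurable f) :
    ∫⁻ ω in avoid C n, f (ω n) ∂(pathLaw P x) = (taboo P C)^[n] f x := by
  induction n generalizing f with
  | zero =>
    have : avoid C 0 = Set.univ := by
      ext ω; simp only [avoid, Set.mem_ofPred_eq, Set.mem_univ, iff_true]; intro m; omega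
    rw [this, Measure.restrict_univ, lintegral_pathLaw_zero P x hf]
    rfl
  | succ n ih =>
    -- The last transition is integrated out, replacing `f` by `taboo P C f`; hence the induction
    -- over all `f`.
    rw [Function.iterate_succ_apply, ← ih (measurable_taboo P hC hf),
      ← lintegral_indicator (measurableSet_avoid hC _),
      ← lintegral_indicator (measurableSet_avoid hC _)]
    have h := lintegral_pathLaw_succ P x n
      (g := (avoidSegment C n).indicator 1)
      (measurable_one.indicator (measurableSet_avoidSegment hC n))
      (f := Cᶜ.indicator f) (hf.indicator hC.compl)
    convert! h using 2
    · ext ω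
      rw [avoid_succ, avoid_eq_preimage]
      by_cases h1 : Preorder.frestrictLe n ω ∈ avoidSegment C n <;>
        by_cases h2 : ω (n + 1) ∈ C <;> simp [Set.indicator, h1, h2]
    · ext ω
      rw [avoid_eq_preimage]
      by_cases h1 : Preorder.frestrictLe n ω ∈ avoidSegment C n <;>
        simp [Set.indicator, h1, taboo, ← lintegral_indicator hC.compl]

theorem pathLaw_avoid (P : Kernel S S) [IsMarkovKernel P] {C : Set S} (hC : MeasurableSet C)
    (x : S) (n : ℕ) : pathLaw P x (avoid C n) = (taboo P C)^[n] 1 x := by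
  rw [← setLIntegral_avoid P hC x n measurable_one]
  simp

/-- The generating function `∑ n, r ^ n * ℙ_x (τ_C⁺ > n)` of the tails of the return time. -/
noncomputable def tailSeries (P : Kernel S S) (r : ℝ≥0∞) (C : Set S) (x : S) : ℝ≥0∞ :=
  ∑' n, r ^ n * (taboo P C)^[n] 1 x

theorem measurable_tailSeries (P : Kernel S S) [IsMarkovKernel P] (r : ℝ≥0∞) {C : Set S}
    (hC : MeasurableSet C) : Measurable (tailSeries P r C) :=
  Measurable.tsum fun n =>
    (measurable_iterate_taboo P hC measurable_one n).const_mul (r ^ n)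

/-- First-step analysis: the term `n = 0` gives `1`, and the others factor through the state at time
1, which must lie off `C`. -/
theorem tailSeries_eq (P : Kernel S S) [IsMarkovKernel P] (r : ℝ≥0∞) {C : Set S}
    (hC : MeasurableSet C) (x : S) :
    tailSeries P r C x = 1 + r * ∫⁻ y in Cᶜ, tailSeries P r C y ∂(P x) := by
  have hm := measurable_iterate_taboo P hC measurable_one
  unfold tailSeries
  rw [tsum_eq_zero_add' ENNReal.summable,
    lintegral_tsum fun n => ((hm n).const_mul (r ^ n)).aemeasurable, ← ENNReal.tsum_mul_left]
  congr 1
  · simp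
  · refine tsum_congr fun n => ?_
    rw [lintegral_const_mul _ (hm n), Function.iterate_succ_apply', pow_succ', mul_assoc]
    rfl

theorem tailSeries_eq_lintegral (P : Kernel S S) [IsMarkovKernel P] (r : ℝ≥0∞) {C : Set S}
    (hC : MeasurableSet C) (x : S) :
    tailSeries P r C x =
      ∫⁻ ω, ∑' n, r ^ n * (avoid C n).indicator 1 ω ∂(pathLaw P x) := by
  have hm : ∀ n, Measurable ((avoid C n).indicator (1 : (ℕ → S) → ℝ≥0∞)) := fun n =>
    measurable_one.indicator (measurableSet_avoid hC n)
  rw [lintegral_tsum fun n => ((hm n).const_mul (r ^ n)).aemeasurable]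
  refine tsum_congr fun n => ?_
  rw [lintegral_const_mul _ (hm n), lintegral_indicator_one (measurableSet_avoid hC n),
    pathLaw_avoid P hC]

theorem tailSeries_one_le (P : Kernel S S) [IsMarkovKernel P] {C : Set S}
    (hC : MeasurableSet C) (x : S) : tailSeries P 1 C x ≤ meanReturnTime P C x := by
  rw [tailSeries_eq_lintegral P 1 hC]
  refine lintegral_mono fun ω => ?_
  rcases h : returnTime C ω with _ | m
  · exact le_top
  · refine (tsum_indicator_avoid_le 1 h).trans ?_
    simp only [one_pow, Finset.sum_const, Finset.card_range, nsmul_eq_mul, mul_one]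
    exact le_rfl

theorem mul_tailSeries_le (P : Kernel S S) [IsMarkovKernel P] (s : ℝ≥0) {C : Set S}
    (hC : MeasurableSet C) (x : S) :
    s * tailSeries P (1 + s) C x ≤ expReturnMoment P (1 + s) C x := by
  rw [tailSeries_eq_lintegral P _ hC, ← lintegral_const_mul' _ _ ENNReal.coe_ne_top]
  refine lintegral_mono fun ω => ?_
  rcases h : returnTime C ω with _ | m
  · exact le_top
  · refine (mul_le_mul_right (tsum_indicator_avoid_le _ h) _).trans ?_
    refine (mul_geom_sum_le_pow _ m).trans_eq ?_
    simp [powTime]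

/-- For an irreducible chain, the tail series is finite almost everywhere as soon as it is finite
at one point. -/
theorem measure_tailSeries_eq_top (P : Kernel S S) [IsMarkovKernel P] {ψ : Measure S}
    (hirr : Kernel.IsIrreducible ψ P) {r : ℝ≥0∞} (hr : r ≠ 0) {C : Set S} (hC : MeasurableSet C)
    (hfin : ∀ x ∈ C, tailSeries P r C x ≠ ∞) (hne : C.Nonempty) :
    ψ {x | tailSeries P r C x = ∞} = 0 := by
  set B := {x | tailSeries P r C x = ∞} with hB
  have hBm : MeasurableSet B := measurable_tailSeries P r hC (measurableSet_singleton ∞)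
  have hBC : B ⊆ Cᶜ := fun x hx hxC => hfin x hxC hx
  -- The complement of `B` is absorbing: by the first-step equation, a finite value at `x` forces
  -- finite values at `P x`-almost every point off `C`, and `B ⊆ Cᶜ`.
  have step : ∀ x, x ∉ B → P x B = 0 := by
    intro x hx
    have hx' : ∫⁻ y in Cᶜ, tailSeries P r C y ∂(P x) ≠ ∞ := by
      intro h
      apply hx
      change tailSeries P r C x = ∞
      rw [tailSeries_eq P r hC, h, ENNReal.mul_top hr, add_top]
    have h := ae_lt_top (measurable_tailSeries P r hC) hx'
    rw [ae_iff, Measure.restrict_apply' hC.compl] at h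
    simp only [not_lt, top_le_iff] at h
    rwa [← hB, Set.inter_eq_left.2 hBC] at h
  have steps : ∀ n x, x ∉ B → (P ^ n) x B = 0 := by
    intro n
    induction n with
    | zero =>
      intro x hx
      rw [pow_zero]
      change Kernel.id x B = 0
      simp [Kernel.id_apply, hBm, hx]
    | succ n ih =>
      intro x hx
      rw [add_comm, Kernel.pow_add_apply_eq_lintegral P 1 n x hBm, pow_one,
        lintegral_eq_zero_iff
        (Kernel.measurable_coe _ hBm)]
      filter_upwards [measure_eq_zero_iff_ae_notMem.1 (step x hx)] with y hy using ih y hy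
  by_contra h
  obtain ⟨x, hx⟩ := hne
  obtain ⟨n, hn⟩ := hirr.irreducible hBm (pos_iff_ne_zero.2 h) x
  exact hn.ne' (steps n x fun h => hBC h hx)

end General

/-! ### Leaving probabilities on petite sets -/

instance isMarkovKernel_pow {S : Type*} [MeasurableSpace S] (P : Kernel S S) [IsMarkovKernel P]
    (n : ℕ) : IsMarkovKernel (P ^ n) := by
  induction n with
  | zero =>
    rw [pow_zero]
    exact inferInstanceAs (IsMarkovKernel Kernel.id)
  | succ n ih =>
    rw [pow_succ]
    exact inferInstanceAs (IsMarkovKernel ((P ^ n) ∘ₖ P))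

/-- The probability of being away from `x` after `n` steps is at most `n` times the probability
of leaving `x` in one step. -/
theorem pow_apply_compl_singleton_le {S : Type*} [MeasurableSpace S] [MeasurableSingletonClass S]
    (P : Kernel S S) [IsMarkovKernel P] (x : S) (n : ℕ) :
    (P ^ n) x {x}ᶜ ≤ n * P x {x}ᶜ := by
  have hm : MeasurableSet ({x}ᶜ : Set S) := (measurableSet_singleton x).compl
  induction n with
  | zero =>
    rw [pow_zero]
    change Kernel.id x {x}ᶜ ≤ _
    simp [Kernel.id_apply, hm]
  | succ n ih =>
    rw [add_comm, Kernel.pow_add_apply_eq_lintegral P 1 n x hm, pow_one]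
    calc
      -- Condition on the first step: if it stays at `x`, induct; otherwise bound the probability by
      -- 1.
      _ ≤ ∫⁻ y, (n * P x {x}ᶜ + ({x}ᶜ : Set S).indicator 1 y) ∂(P x) := by
        refine lintegral_mono fun y => ?_
        by_cases hy : y = x
        · subst hy; simpa using ih
        · simpa [hy] using (prob_le_one (μ := (P ^ n) y) (s := {x}ᶜ)).trans le_add_self
      _ = _ := by
        rw [lintegral_add_left measurable_const, lintegral_indicator_one hm]
        simp [add_mul, add_comm]

/-- On a petite set, the probabilities of leaving a state are bounded below, up to one exceptional
state. -/
theorem IsPetite.exists_le_apply_compl_singleton {S : Type*} [MeasurableSpace S]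
    [MeasurableSingletonClass S] [Countable S] {P : Kernel S S} [IsMarkovKernel P] {C : Set S}
    (hC : IsPetite P C) :
    ∃ k, ∃ c : ℝ≥0∞, 0 < c ∧ ∀ x ∈ C, x ≠ k → c ≤ P x {x}ᶜ := by
  obtain ⟨-, a, ν, ha, hν, h⟩ := hC
  obtain ⟨k, hk⟩ : ∃ k, ν {k} ≠ 0 := by
    by_contra! hall
    refine hν (Measure.measure_univ_eq_zero.1 ?_)
    rw [← Set.biUnion_of_singleton (Set.univ : Set S)]
    exact (measure_biUnion_null_iff Set.countable_univ).2 fun k _ => hall k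
  have htail := ENNReal.tendsto_sum_nat_add a (by simp [ha])
  obtain ⟨N, hN⟩ := ((tendsto_order.1 htail).2 _ (pos_iff_ne_zero.2 hk)).exists
  -- From `x ≠ k`, reaching `k` requires leaving `x`. Times below `N` contribute at most `N * P x
  -- {x}ᶜ`, later ones at most the tail of `a`, chosen smaller than `ν {k}`.
  refine ⟨k, (ν {k} - ∑' i, a (i + N)) / N, ?_, fun x hx hxk => ?_⟩
  · exact ENNReal.div_pos (tsub_pos_of_lt hN).ne' (ENNReal.natCast_ne_top N)
  · refine ENNReal.div_le_of_le_mul ?_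
    rw [tsub_le_iff_right]
    have hsub : ∀ n, (P ^ n) x {k} ≤ (P ^ n) x {x}ᶜ := fun n =>
      measure_mono (by simpa using hxk)
    calc
      ν {k} ≤ ∑' n, a n * (P ^ n) x {k} := h x hx _ (measurableSet_singleton k)
      _ = ∑ n ∈ Finset.range N, a n * (P ^ n) x {k} + ∑' n, a (n + N) * (P ^ (n + N)) x {k} :=
        (ENNReal.summable.sum_add_tsum_nat_add' ).symm
      _ ≤ ∑ n ∈ Finset.range N, a n * (N * P x {x}ᶜ) + ∑' n, a (n + N) := by
        gcongr with n hn n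
        · refine ((hsub n).trans (pow_apply_compl_singleton_le P x n)).trans ?_
          gcongr
          exact (Finset.mem_range.1 hn).le
        · exact mul_le_of_le_one_right' prob_le_one
      _ ≤ P x {x}ᶜ * N + ∑' i, a (i + N) := by
        gcongr
        rw [← Finset.sum_mul, mul_comm (N : ℝ≥0∞)]
        exact mul_le_of_le_one_left' ((ENNReal.sum_le_tsum _).trans ha.le)

/-! ### Holding times of the single-death chain and the three criteria -/

namespace SingleDeath

theorem kernel_apply_singleton (R : SingleDeath) (i j : ℕ) :
    R.kernel i {j} = ENNReal.ofReal (R.matrix i j) := by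
  change R.row i {j} = _
  rw [row, Measure.sum_apply _ (measurableSet_singleton j), tsum_eq_single j]
  · simp
  · intro k hk
    simp [hk]

theorem lintegral_kernel (R : SingleDeath) (i : ℕ) (f : ℕ → ℝ≥0∞) :
    ∫⁻ j, f j ∂(R.kernel i) = ∑' j, ENNReal.ofReal (R.matrix i j) * f j := by
  rw [lintegral_countable']
  simp_rw [kernel_apply_singleton, mul_comm]

theorem matrix_self (R : SingleDeath) {i : ℕ} (hi : 2 ≤ i) :
    R.matrix i i = 1 - (R.p i + R.γ i) := by
  have h0 : i ≠ 0 := by omega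
  simp [matrix, hi, h0]
  ring

theorem kernel_apply_compl_singleton (R : SingleDeath) {i : ℕ} (hi : 2 ≤ i) :
    R.kernel i {i}ᶜ = ENNReal.ofReal (R.p i + R.γ i) := by
  rw [prob_compl_eq_one_sub (measurableSet_singleton i), kernel_apply_singleton, R.matrix_self hi,
    ← ENNReal.ofReal_one, ← ENNReal.ofReal_sub _ (by linarith [R.le_one i hi])]
  congr 1
  ring

theorem exists_le_of_isPetite (R : SingleDeath) {C : Set ℕ} (hC : IsPetite R.kernel C) :
    ∃ c : ℝ, 0 < c ∧ ∀ i ∈ C, 2 ≤ i → c ≤ R.p i + R.γ i := by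
  obtain ⟨k, c, hc, h⟩ := hC.exists_le_apply_compl_singleton
  obtain ⟨c', hc', hcc'⟩ := ENNReal.lt_iff_exists_nnreal_btwn.1 hc
  have hc'0 : 0 < (c' : ℝ) := by exact_mod_cast hc'
  have key : ∀ i ∈ C, 2 ≤ i → i ≠ k → (c' : ℝ) ≤ R.p i + R.γ i := by
    intro i hi h2 hik
    have := hcc'.le.trans (h i hi hik)
    rw [R.kernel_apply_compl_singleton h2, ← ENNReal.ofReal_coe_nnreal] at this
    exact (ENNReal.ofReal_le_ofReal_iff (add_nonneg (R.p_nonneg i) (R.γ_nonneg i))).1 this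
  by_cases hk : 2 ≤ k
  -- The exceptional state is harmless, since its own leaving probability is positive.
  · refine ⟨min c' (R.p k + R.γ k), lt_min hc'0 (by linarith [R.pos k hk]), fun i hi h2 => ?_⟩
    by_cases hik : i = k
    · subst hik; exact min_le_right _ _
    · exact (min_le_left _ _).trans (key i hi h2 hik)
  · exact ⟨c', hc'0, fun i hi h2 => key i hi h2 (by omega)⟩

/-- The tail series at a state `i ∉ C` dominates the contribution of the holding time at `i`. -/
theorem one_add_le_tailSeries (R : SingleDeath) (r : ℝ≥0∞) {C : Set ℕ} {i : ℕ} (hi : 2 ≤ i)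
    (hiC : i ∉ C) :
    1 + r * (ENNReal.ofReal (1 - (R.p i + R.γ i)) * tailSeries R.kernel r C i) ≤
      tailSeries R.kernel r C i := by
  conv_rhs => rw [tailSeries_eq R.kernel r (MeasurableSet.of_discrete)]
  gcongr
  rw [← lintegral_indicator MeasurableSet.of_discrete, lintegral_kernel]
  refine le_trans ?_ (ENNReal.le_tsum i)
  rw [R.matrix_self hi]
  simp [hiC]

/-- The holding time at `i` is geometric with mean `1 / q i`, and `C` is not entered during it. -/
theorem ofReal_inv_le_tailSeries (R : SingleDeath) {C : Set ℕ} {i : ℕ} (hi : 2 ≤ i)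
    (hiC : i ∉ C) :
    ENNReal.ofReal (R.p i + R.γ i)⁻¹ ≤ tailSeries R.kernel 1 C i := by
  have h := R.one_add_le_tailSeries 1 hi hiC
  have hq : 0 < R.p i + R.γ i := by linarith [R.pos i hi]
  have hq1 : R.p i + R.γ i ≤ 1 := by linarith [R.le_one i hi]
  rcases eq_or_ne (tailSeries R.kernel 1 C i) ∞ with ht | ht
  · simp [ht]
  · rw [ENNReal.ofReal_le_iff_le_toReal ht]
    have h' := ENNReal.toReal_mono ht h
    rw [one_mul, ENNReal.toReal_add ENNReal.one_ne_top (by finiteness), ENNReal.toReal_mul,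
      ENNReal.toReal_ofReal (by linarith), ENNReal.toReal_one] at h'
    rw [inv_le_iff_one_le_mul₀ hq]
    linarith

theorem tailSeries_ne_top (R : SingleDeath)
    (hirr : Kernel.IsIrreducible (Measure.count : Measure ℕ) R.kernel) {r : ℝ≥0∞} (hr : r ≠ 0)
    {C : Set ℕ} (hne : C.Nonempty) (hfin : ∀ x ∈ C, tailSeries R.kernel r C x ≠ ∞) (x : ℕ) :
    tailSeries R.kernel r C x ≠ ∞ := by
  have h := measure_tailSeries_eq_top R.kernel hirr hr MeasurableSet.of_discrete hfin hne
  rw [Measure.count_eq_zero_iff] at h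
  exact fun hx => h.subset hx

theorem not_isErgodic (R : SingleDeath)
    (hirr : Kernel.IsIrreducible (Measure.count : Measure ℕ) R.kernel) (i₀ : ℕ) (hi₀ : 0 < i₀)
    (hsum : ∑' k : ℕ,
      ENNReal.ofReal (R.β (i₀ + k) / (R.p (i₀ + k) + R.γ (i₀ + k))) = ∞) :
    ¬ IsErgodic R.kernel Measure.count := by
  rintro ⟨-, C, hC, hpos, hsup⟩
  have hne : C.Nonempty := nonempty_of_measure_ne_zero hpos.ne'
  have hfin : ∀ x ∈ C, tailSeries R.kernel 1 C x ≠ ∞ := fun x hx =>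
    ((tailSeries_one_le R.kernel hC.1 x).trans_lt ((le_iSup₂ (f := fun x _ =>
      meanReturnTime R.kernel C x) x hx).trans_lt hsup)).ne
  have h0 := R.tailSeries_ne_top hirr one_ne_zero hne hfin 0
  obtain ⟨c, hc, hcC⟩ := R.exists_le_of_isPetite hC
  rw [tailSeries_eq R.kernel 1 hC.1, one_mul, ← lintegral_indicator hC.1.compl,
    lintegral_kernel] at h0
  have h1 := (ENNReal.add_ne_top.1 h0).2
  have hβ : ∑' j, ENNReal.ofReal (R.β j) ≠ ∞ := by
    rw [← ENNReal.ofReal_tsum_of_nonneg R.β_nonneg R.hasSum_β.summable]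
    exact ENNReal.ofReal_ne_top
  set u : ℕ → ℝ≥0∞ := fun j => ENNReal.ofReal (R.β j / (R.p j + R.γ j))
  -- The three terms cover `j ∉ C` (long holding time), `j ∈ C` (where `q j ≥ c`) and `j = 1`, where
  -- `γ 1` is unconstrained but the single term is finite.
  have hbound : ∀ j, 0 < j → u j ≤ ENNReal.ofReal (R.matrix 0 j) *
      Cᶜ.indicator (tailSeries R.kernel 1 C) j + ENNReal.ofReal (R.β j) * ENNReal.ofReal c⁻¹ +
      (if j = 1 then u 1 else 0) := by
    intro j hj
    rcases Nat.lt_or_ge j 2 with h2 | h2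
    · obtain rfl : j = 1 := by omega
      simp
    have hq : 0 < R.p j + R.γ j := by linarith [R.pos j h2]
    have hu' : u j = ENNReal.ofReal (R.β j) * ENNReal.ofReal (R.p j + R.γ j)⁻¹ := by
      rw [← ENNReal.ofReal_mul (R.β_nonneg j), ← div_eq_mul_inv]
    refine le_trans ?_ le_self_add
    rw [hu']
    by_cases hjC : j ∈ C
    · refine le_trans ?_ le_add_self
      gcongr
      exact hcC j hjC h2
    · refine le_trans ?_ le_self_add
      have hm : R.matrix 0 j = R.β j := by simp [matrix]
      rw [hm, Set.indicator_of_mem (show j ∈ Cᶜ from hjC)]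
      gcongr
      exact R.ofReal_inv_le_tailSeries h2 hjC
  have hle : ∑' k, u (i₀ + k) ≤ ∑' j, (ENNReal.ofReal (R.matrix 0 j) *
      Cᶜ.indicator (tailSeries R.kernel 1 C) j + ENNReal.ofReal (R.β j) * ENNReal.ofReal c⁻¹ +
      (if j = 1 then u 1 else 0)) :=
    (ENNReal.tsum_le_tsum fun k => hbound (i₀ + k) (by omega)).trans
      (ENNReal.tsum_comp_le_tsum_of_injective (add_right_injective i₀) _)
  refine (ne_top_of_le_ne_top ?_ hle) hsum
  rw [ENNReal.tsum_add, ENNReal.tsum_add, ENNReal.tsum_mul_right, tsum_ite_eq]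
  exact ENNReal.add_ne_top.2 ⟨ENNReal.add_ne_top.2
    ⟨h1, ENNReal.mul_ne_top hβ ENNReal.ofReal_ne_top⟩, ENNReal.ofReal_ne_top⟩

theorem tendsto_leave_zero (R : SingleDeath) {a : ℝ} (ha : 0 < a)
    (h : ∀ i : ℕ, 2 ≤ i → R.γ i + a * R.p i ≤ (i : ℝ) ^ (-a)) :
    Tendsto (fun i => R.p i + R.γ i) atTop (nhds 0) := by
  have hlim : Tendsto (fun i : ℕ => (1 + a⁻¹) * (i : ℝ) ^ (-a)) atTop (nhds 0) := by
    simpa using ((tendsto_rpow_neg_atTop ha).comp tendsto_natCast_atTop_atTop).const_mul (1 + a⁻¹)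
  refine squeeze_zero' (.of_forall fun i => add_nonneg (R.p_nonneg i) (R.γ_nonneg i)) ?_ hlim
  filter_upwards [eventually_ge_atTop 2] with i hi
  have hp := R.p_nonneg i
  have hγ := R.γ_nonneg i
  calc
    R.p i + R.γ i ≤ (1 + a⁻¹) * (R.γ i + a * R.p i) := by
      have : (1 + a⁻¹) * (R.γ i + a * R.p i) = R.p i + R.γ i + (a * R.p i + a⁻¹ * R.γ i) := by
        field_simp
        ring
      rw [this]
      have := inv_pos.2 ha
      have : 0 ≤ a * R.p i + a⁻¹ * R.γ i := by positivity
      linarith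
    _ ≤ _ := by
      gcongr
      exact h i hi

theorem not_isGeometricallyErgodic (R : SingleDeath)
    (hirr : Kernel.IsIrreducible (Measure.count : Measure ℕ) R.kernel)
    (hlim : Tendsto (fun i => R.p i + R.γ i) atTop (nhds 0)) :
    ¬ IsGeometricallyErgodic R.kernel Measure.count := by
  rintro ⟨C, hC, hpos, r, hr, hsup⟩
  have hne : C.Nonempty := nonempty_of_measure_ne_zero hpos.ne'
  obtain ⟨s, hs, rfl⟩ : ∃ s : ℝ≥0, 0 < s ∧ r = 1 + s :=
    ⟨r - 1, tsub_pos_of_lt hr, (add_tsub_cancel_of_le hr.le).symm⟩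
  have hfin : ∀ x ∈ C, tailSeries R.kernel (1 + s) C x ≠ ∞ := by
    intro x hx ht
    have h := (mul_tailSeries_le R.kernel s hC.1 x).trans_lt ((le_iSup₂ (f := fun x _ =>
      expReturnMoment R.kernel (1 + s) C x) x hx).trans_lt hsup)
    rw [ht, ENNReal.mul_top (by simpa using hs.ne')] at h
    exact h.ne rfl
  obtain ⟨c, hc, hcC⟩ := R.exists_le_of_isPetite hC
  -- With `r = 1 + s`, the inequality `r (1 - q i) ≥ 1` amounts to `q i ≤ s / (1 + s)`.
  have hs' : 0 < (s : ℝ) / (1 + s) := by positivity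
  obtain ⟨i, hi, h2⟩ := (((tendsto_order.1 hlim).2 _ (lt_min hc hs')).and
    (eventually_ge_atTop 2)).exists
  have hiC : i ∉ C := fun h => (hcC i h h2).not_gt (hi.trans_le (min_le_left _ _))
  have htop := R.tailSeries_ne_top hirr (by simp) hne hfin i
  have hle := R.one_add_le_tailSeries (1 + s) h2 hiC
  have hge : 1 ≤ (1 + s : ℝ≥0∞) * ENNReal.ofReal (1 - (R.p i + R.γ i)) := by
    have hi' := hi.trans_le (min_le_right _ _)
    rw [lt_div_iff₀ (by positivity)] at hi'
    have h1s : (1 + s : ℝ≥0∞) = ENNReal.ofReal (1 + s) := by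
      rw [ENNReal.ofReal_add zero_le_one s.coe_nonneg, ENNReal.ofReal_one,
        ENNReal.ofReal_coe_nnreal]
    rw [h1s, ← ENNReal.ofReal_mul (by positivity), ENNReal.one_le_ofReal]
    linarith
  rw [← mul_assoc] at hle
  have h1 : 1 + tailSeries R.kernel (1 + s) C i ≤ tailSeries R.kernel (1 + s) C i :=
    (by gcongr; exact le_mul_of_one_le_left' hge : _ ≤ _).trans hle
  have := ENNReal.lt_add_right htop one_ne_zero
  exact this.not_ge ((add_comm _ _).trans_le h1)

theorem not_isStronglyErgodic (R : SingleDeath)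
    (hinf : (⨅ i : {i : ℕ // 2 ≤ i}, (R.p i + R.γ i)) = 0) :
    ¬ IsStronglyErgodic R.kernel := by
  rintro ⟨C, hC, hsup⟩
  obtain ⟨c, hc, hcC⟩ := R.exists_le_of_isPetite hC
  set M := (⨆ x, meanReturnTime R.kernel C x).toReal
  -- Off `C`, `1 / q i ≤ M`; using `M + 1` keeps the lower bound positive even if `M = 0`.
  have hb : ∀ i : {i : ℕ // 2 ≤ i}, min c (M + 1)⁻¹ ≤ R.p i + R.γ i := by
    rintro ⟨i, hi⟩
    by_cases hiC : i ∈ C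
    · exact (min_le_left _ _).trans (hcC i hiC hi)
    · refine (min_le_right _ _).trans ?_
      have hq : 0 < R.p i + R.γ i := by linarith [R.pos i hi]
      have h := (R.ofReal_inv_le_tailSeries hi hiC).trans
        ((tailSeries_one_le R.kernel hC.1 i).trans (le_iSup (meanReturnTime R.kernel C) i))
      rw [ENNReal.ofReal_le_iff_le_toReal hsup.ne] at h
      exact inv_le_of_inv_le₀ hq (h.trans (by linarith))
  have hM0 : 0 ≤ M := ENNReal.toReal_nonneg
  have : Nonempty {i : ℕ // 2 ≤ i} := ⟨⟨2, le_rfl⟩⟩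
  have h := le_ciInf hb
  rw [hinf] at h
  exact h.not_gt (lt_min hc (by positivity))

end SingleDeath

end MarkovChain

theorem proposition8 (R : MarkovChain.SingleDeath)
    (hirr : Kernel.IsIrreducible (Measure.count : Measure ℕ) R.kernel) :
    ((∃ i₀ : ℕ, 0 < i₀ ∧
        ∑' k : ℕ, ENNReal.ofReal (R.β (i₀ + k) / (R.p (i₀ + k) + R.γ (i₀ + k))) = ∞) →
      ¬ MarkovChain.IsErgodic R.kernel Measure.count) ∧
    ((∃ a : ℝ, 0 < a ∧ ∀ i : ℕ, 2 ≤ i → R.γ i + a * R.p i ≤ (i : ℝ) ^ (-a)) →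
      ¬ MarkovChain.IsGeometricallyErgodic R.kernel Measure.count) ∧
    ((⨅ i : {i : ℕ // 2 ≤ i}, (R.p i + R.γ i)) = 0 →
      ¬ MarkovChain.IsStronglyErgodic R.kernel) := by
  refine ⟨?_, ?_, R.not_isStronglyErgodic⟩
  · rintro ⟨i₀, hi₀, hsum⟩
    exact R.not_isErgodic hirr i₀ hi₀ hsum
  · rintro ⟨a, ha, h⟩
    exact R.not_isGeometricallyErgodic hirr (R.tendsto_leave_zero ha h)
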